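/- Let $G$ be a finite acyclic directed graph. Write $g_1\ge g_2$ in $G$-order if there is a (possibly empty) directed path in $G$ from $g_1$ to $g_2$. A set of vertices is independent if its elements are pairwise non-adjacent. A pair $(X,Y)$ of sets of vertices is orthogonal if $X\cap Y=\emptyset$ and no edge of $G$ goes from an element of $X$ to an element of $Y$. The lattice $\mathcal L(G)$. A maximal orthogonal pair is an orthogonal pair $(X,Y)$ such that neither $X$ nor $Y$ can be enlarged. $\mathcal L(G)$ is the set of maximal orthogonal pairs, ordered by $(X,Y)\le (X',Y')$ iff $X\subseteq X'$ (equivalently, $Y'\subseteq Y$); it is a lattice, in which the join intersects the second components and the meet intersects the first components. A finite lattice $L$ is trim if (i) it is extremal: the length $r$ of its longest chains $x_0<x_1<\dots<x_r$ equals both the number of join-irreducible elements and the number of meet-irreducible elements of $L$; and (ii) it is left modular: it has a maximal chain consisting of left modular elements, where $x$ is left modular if $(y\vee x)\wedge z=y\vee(x\wedge z)$ for all $y\le z$. The independence poset $\mathrm{top}(G)$. An orthogonal pair $(\mathcal D,\mathcal U)$ of independent sets is tight if it stops being an orthogonal pair of independent sets whenever a new vertex is added to $\mathcal D$ or to $\mathcal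 U$, whenever one or more elements of $\mathcal D$ are removed and replaced by a vertex $k\notin\mathcal D$ that is larger than each of them, and whenever one or more elements of $\mathcal U$ are removed and replaced by a vertex $k\notin\mathcal U$ that is smaller than each of them. Fix a linear extension $\ell$ of $G$-order (smaller vertices come first) and a reverse linear extension $\ell'$ (larger vertices come first). For a tight orthogonal pair $(\mathcal D,\mathcal U)$ and a vertex $g$, define $\mathrm{flip}_g(\mathcal D,\mathcal U)$ as follows. If $g\notin\mathcal D\cup\mathcal U$, it is $(\mathcal D,\mathcal U)$. Otherwise let $\mathcal D'=\{k\in\mathcal D:k\not\le g\}$ and $\mathcal U'=\{k\in\mathcal U:k\not\ge g\}$, and add $g$ to $\mathcal D'$ if $g\in\mathcal U$, and to $\mathcal U'$ if $g\in\mathcal D$. Then run through the vertices $k$ in the order $\ell'$, adding $k$ to $\mathcal D'$ if $k\not\ge g$, $k\notin\mathcal U'$, there is no edge from $k$ to the current $\mathcal U'$ and no edge from the current $\mathcal D'$ to $k$. Finally run through the vertices $k$ in the order $\ell$, adding $k$ to $\mathcal U'$ if $k\not\le g$, $k\notin\mathcal D'$, there is no edge from the current $\mathcal D'$ to $k$ and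 no edge from $k$ to the current $\mathcal U'$. The result is $\mathrm{flip}_g(\mathcal D,\mathcal U)=(\mathcal D',\mathcal U')$. The set $\mathrm{top}(G)$ of all tight orthogonal pairs carries the reflexive and transitive closure of the relations $(\mathcal D,\mathcal U)<\mathrm{flip}_g(\mathcal D,\mathcal U)$ for $g\in\mathcal U$. Theorem. If $\mathcal L(G)$ is a trim lattice, then $\mathcal L(G)$ and $\mathrm{top}(G)$ are isomorphic as ordered sets (for every choice of $\ell$ and $\ell'$). -/

import Mathlib

open Relation

namespace Digraph

variable {V : Type*}

/-- A directed graph is acyclic if no vertex is reached from itself by a nonempty directed path. -/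
def IsAcyclic (G : Digraph V) : Prop := ∀ v, ¬ TransGen G.Adj v v

/-- `G.Geq a b` : `a ≥ b` in `G`-order, i.e. there is a directed path from `a` to `b`. -/
def Geq (G : Digraph V) (a b : V) : Prop := ReflTransGen G.Adj a b

/-- `ℓ` lists all the vertices, without repetition, as a linear extension of `G`-order:
a vertex never precedes a vertex that lies below it. -/
def IsLinearExtension (G : Digraph V) (ℓ : List V) : Prop :=
  ℓ.Nodup ∧ (∀ v, v ∈ ℓ) ∧ ℓ.Pairwise (fun a b => ¬ G.Geq a b)

/-- A reverse linear extension of `G`-order: the same list read backwards is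
a linear extension. -/
def IsReverseLinearExtension (G : Digraph V) (ℓ : List V) : Prop :=
  G.IsLinearExtension ℓ.reverse

/-- A set of pairwise non-adjacent vertices. -/
def IsIndependent (G : Digraph V) (A : Set V) : Prop := ∀ a ∈ A, ∀ b ∈ A, ¬ G.Adj a b

/-- `X` and `Y` are disjoint and there is no edge from `X` to `Y`. -/
def IsOrthogonal (G : Digraph V) (X Y : Set V) : Prop :=
  Disjoint X Y ∧ ∀ x ∈ X, ∀ y ∈ Y, ¬ G.Adj x y

/-! ### Maximal orthogonal pairs -/

/-- The maximal orthogonal pairs of `G`. -/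
@[ext]
structure Mop (G : Digraph V) where
  X : Set V
  Y : Set V
  maximal : Maximal (fun p : Set V × Set V => G.IsOrthogonal p.1 p.2) (X, Y)

namespace Mop

variable {G : Digraph V}

/-- The vertices that may be put in a second component orthogonal to `X`. -/
def rightPerp (G : Digraph V) (X : Set V) : Set V := {v | v ∉ X ∧ ∀ x ∈ X, ¬ G.Adj x v}

/-- The vertices that may be put in a first component orthogonal to `Y`. -/
def leftPerp (G : Digraph V) (Y : Set V) : Set V := {v | v ∉ Y ∧ ∀ y ∈ Y, ¬ G.Adj v y}

theorem orth_iff_right {X Y : Set V} : G.IsOrthogonal X Y ↔ Y ⊆ rightPerp G X :=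
  ⟨fun h y hy => ⟨fun hx => Set.disjoint_left.1 h.1 hx hy, fun x hx => h.2 x hx y hy⟩,
    fun h => ⟨Set.disjoint_left.2 fun _ hx hy => (h hy).1 hx, fun x hx _ hy => (h hy).2 x hx⟩⟩

theorem orth_iff_left {X Y : Set V} : G.IsOrthogonal X Y ↔ X ⊆ leftPerp G Y :=
  ⟨fun h x hx => ⟨fun hy => Set.disjoint_left.1 h.1 hx hy, fun y hy => h.2 x hx y hy⟩,
    fun h => ⟨Set.disjoint_left.2 fun _ hx hy => (h hx).1 hy, fun _ hx y hy => (h hx).2 y hy⟩⟩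

theorem Y_eq (p : Mop G) : p.Y = rightPerp G p.X := by
  refine Set.Subset.antisymm (orth_iff_right.1 p.maximal.prop) ?_
  exact (p.maximal.le_of_ge (y := (p.X, rightPerp G p.X)) (orth_iff_right.2 subset_rfl)
    ⟨le_rfl, orth_iff_right.1 p.maximal.prop⟩).2

theorem X_eq (p : Mop G) : p.X = leftPerp G p.Y := by
  refine Set.Subset.antisymm (orth_iff_left.1 p.maximal.prop) ?_
  exact (p.maximal.le_of_ge (y := (leftPerp G p.Y, p.Y)) (orth_iff_left.2 subset_rfl)
    ⟨orth_iff_left.1 p.maximal.prop, le_rfl⟩).1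

theorem maximal_of_eq {X Y : Set V} (hY : Y = rightPerp G X) (hX : X = leftPerp G Y) :
    Maximal (fun p : Set V × Set V => G.IsOrthogonal p.1 p.2) (X, Y) := by
  refine ⟨orth_iff_right.2 hY.subset, fun q hq hle => ⟨?_, ?_⟩⟩
  · rw [show (X, Y).1 = leftPerp G Y from hX]
    exact fun x hx => ⟨fun hy => Set.disjoint_left.1 hq.1 hx (hle.2 hy),
      fun y hy => hq.2 x hx y (hle.2 hy)⟩
  · rw [show (X, Y).2 = rightPerp G X from hY]
    exact fun y hy => ⟨fun hx => Set.disjoint_left.1 hq.1 (hle.1 hx) hy,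
      fun x hx => hq.2 x (hle.1 hx) y hy⟩

theorem rightPerp_anti {X X' : Set V} (h : X ⊆ X') : rightPerp G X' ⊆ rightPerp G X :=
  fun _ hv => ⟨fun hx => hv.1 (h hx), fun x hx => hv.2 x (h hx)⟩

theorem leftPerp_anti {Y Y' : Set V} (h : Y ⊆ Y') : leftPerp G Y' ⊆ leftPerp G Y :=
  fun _ hv => ⟨fun hy => hv.1 (h hy), fun y hy => hv.2 y (h hy)⟩

theorem left_right {X : Set V} : X ⊆ leftPerp G (rightPerp G X) :=
  orth_iff_left.1 (orth_iff_right.2 subset_rfl)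

theorem right_left {Y : Set V} : Y ⊆ rightPerp G (leftPerp G Y) :=
  orth_iff_right.1 (orth_iff_left.2 subset_rfl)

/-- The order of `𝓛(G)`: inclusion of first components. -/
instance : PartialOrder (Mop G) where
  le p q := p.X ⊆ q.X
  le_refl _ := subset_rfl
  le_trans _ _ _ h h' := Set.Subset.trans h h'
  le_antisymm p q h h' := by
    have hX : p.X = q.X := Set.Subset.antisymm h h'
    exact Mop.ext hX (by rw [p.Y_eq, q.Y_eq, hX])

theorem le_def {p q : Mop G} : p ≤ q ↔ p.X ⊆ q.X := Iff.rfl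

/-- Equivalently, the order of `𝓛(G)` is reverse inclusion of second components. -/
theorem le_iff_Y {p q : Mop G} : p ≤ q ↔ q.Y ⊆ p.Y := by
  refine ⟨fun h => ?_, fun h => ?_⟩
  · rw [p.Y_eq, q.Y_eq]; exact rightPerp_anti h
  · rw [le_def, p.X_eq, q.X_eq]; exact leftPerp_anti h

/-- The lattice `𝓛(G)`: joins intersect the second components and meets intersect
the first components. -/
instance : Lattice (Mop G) where
  sup p q :=
    { X := leftPerp G (p.Y ∩ q.Y)
      Y := p.Y ∩ q.Y
      maximal := by
        refine maximal_of_eq (Set.Subset.antisymm right_left (Set.subset_inter ?_ ?_)) rfl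
        · rw [p.Y_eq]; refine rightPerp_anti ?_
          rw [← p.Y_eq, p.X_eq]; exact leftPerp_anti Set.inter_subset_left
        · rw [q.Y_eq]; refine rightPerp_anti ?_
          rw [← q.Y_eq, q.X_eq]; exact leftPerp_anti Set.inter_subset_right }
  inf p q :=
    { X := p.X ∩ q.X
      Y := rightPerp G (p.X ∩ q.X)
      maximal := by
        refine maximal_of_eq rfl (Set.Subset.antisymm left_right (Set.subset_inter ?_ ?_))
        · rw [p.X_eq]; refine leftPerp_anti ?_
          rw [← p.X_eq, p.Y_eq]; exact rightPerp_anti Set.inter_subset_left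
        · rw [q.X_eq]; refine leftPerp_anti ?_
          rw [← q.X_eq, q.Y_eq]; exact rightPerp_anti Set.inter_subset_right }
  le_sup_left _ _ := le_iff_Y.2 Set.inter_subset_left
  le_sup_right _ _ := le_iff_Y.2 Set.inter_subset_right
  sup_le _ _ _ h h' := le_iff_Y.2 (Set.subset_inter (le_iff_Y.1 h) (le_iff_Y.1 h'))
  inf_le_left _ _ := Set.inter_subset_left
  inf_le_right _ _ := Set.inter_subset_right
  le_inf _ _ _ h h' := Set.subset_inter h h'

end Mop

/-! ### Tight orthogonal pairs -/

/-- `(D, U)` is an orthogonal pair of independent sets. -/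
def IsOrthIndep (G : Digraph V) (D U : Set V) : Prop :=
  G.IsIndependent D ∧ G.IsIndependent U ∧ G.IsOrthogonal D U

/-- An orthogonal pair `(D, U)` of independent sets is tight if the result is never again an
orthogonal pair of independent sets when a new vertex is added to `D` or to `U`, when elements
of `D` (one or several of them) are removed and replaced by a larger new vertex, or when elements
of `U` are removed and replaced by a smaller new vertex. -/
structure IsTight (G : Digraph V) (D U : Set V) : Prop where
  orthIndep : G.IsOrthIndep D U
  not_insert_left : ∀ k, k ∉ D → ¬ G.IsOrthIndep (insert k D) U
  not_insert_right : ∀ k, k ∉ U → ¬ G.IsOrthIndep D (insert k U)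
  not_increase : ∀ S ⊆ D, S.Nonempty → ∀ k, k ∉ D → (∀ d ∈ S, G.Geq k d) →
    ¬ G.IsOrthIndep (insert k (D \ S)) U
  not_decrease : ∀ S ⊆ U, S.Nonempty → ∀ k, k ∉ U → (∀ u ∈ S, G.Geq u k) →
    ¬ G.IsOrthIndep D (insert k (U \ S))

open Classical in
/-- The flip of `(D, U)` at `g`. If `g ∉ D` and `g ∉ U`, nothing happens. Otherwise delete from `D`
the elements `≤ g` and from `U` the elements `≥ g`, put `g` into the set in which it was not, then
run through `ℓ'` adding to the first set every admissible vertex that is not `≥ g`, and finally run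
through `ℓ` adding to the second set every admissible vertex that is not `≤ g`. -/
noncomputable def flip (G : Digraph V) (ℓ ℓ' : List V) (g : V) (p : Set V × Set V) :
    Set V × Set V :=
  let D := p.1
  let U := p.2
  if g ∉ D ∧ g ∉ U then (D, U)
  else
    let D₀ : Set V := {k | k ∈ D ∧ ¬ G.Geq g k} ∪ {k | k = g ∧ g ∈ U}
    let U₀ : Set V := {k | k ∈ U ∧ ¬ G.Geq k g} ∪ {k | k = g ∧ g ∈ D}
    let D₁ : Set V := ℓ'.foldl (fun A k =>
      if ¬ G.Geq k g ∧ k ∉ U₀ ∧ (∀ i ∈ U₀, ¬ G.Adj k i) ∧ (∀ i ∈ A, ¬ G.Adj i k)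
        then insert k A else A) D₀
    let U₁ : Set V := ℓ.foldl (fun B k =>
      if ¬ G.Geq g k ∧ k ∉ D₁ ∧ (∀ i ∈ D₁, ¬ G.Adj i k) ∧ (∀ i ∈ B, ¬ G.Adj k i)
        then insert k B else B) U₀
    (D₁, U₁)

/-- The set `top(G)` of tight orthogonal pairs. The lists `ℓ` and `ℓ'` (a linear extension and
a reverse linear extension of `G`-order) only serve to compute flips, hence the order. -/
@[ext]
structure IndependencePoset (G : Digraph V) (ℓ ℓ' : List V) where
  D : Set V
  U : Set V
  tight : G.IsTight D U

namespace IndependencePoset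

variable {G : Digraph V} {ℓ ℓ' : List V}

/-- `y` is obtained from `x` by an upward flip, at some `g` in the second component of `x`. -/
def FlipUp (x y : IndependencePoset G ℓ ℓ') : Prop :=
  ∃ g ∈ x.U, G.flip ℓ ℓ' g (x.D, x.U) = (y.D, y.U)

/-- The independence relations: the reflexive and transitive closure of upward flips. -/
instance : Preorder (IndependencePoset G ℓ ℓ') where
  le := ReflTransGen FlipUp
  le_refl _ := ReflTransGen.refl
  le_trans _ _ _ := ReflTransGen.trans

end IndependencePoset

end Digraph

/-! ### Trim lattices -/

/-- Left modular elements of a lattice. -/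
def IsLeftModular {α : Type*} [Lattice α] (x : α) : Prop :=
  ∀ y z : α, y ≤ z → (y ⊔ x) ⊓ z = y ⊔ (x ⊓ z)

/-- A (finite) lattice is left modular if it has a maximal chain of left modular elements. -/
def IsLeftModularLattice (α : Type*) [Lattice α] : Prop :=
  ∃ C : Set α, IsMaxChain (· ≤ ·) C ∧ ∀ x ∈ C, IsLeftModular x

/-- A (finite) lattice is extremal if the length of its longest chains (a chain
`x₀ < x₁ < ⋯ < xᵣ` has length `r`) is both the number of its join-irreducible elements and
the number of its meet-irreducible elements. -/
def IsExtremalLattice (α : Type*) [Lattice α] : Prop :=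
  Order.krullDim α = ((Set.encard {a : α | SupIrred a} : ℕ∞) : WithBot ℕ∞) ∧
  Order.krullDim α = ((Set.encard {a : α | InfIrred a} : ℕ∞) : WithBot ℕ∞)

/-- A (finite) lattice is trim if it is extremal and left modular. -/
def IsTrimLattice (α : Type*) [Lattice α] : Prop :=
  IsExtremalLattice α ∧ IsLeftModularLattice α

/-! A maximal chain of left modular elements is at least as long as any other chain, in particular
the chain of down-sets cut out by a linear extension. In `𝓛(G)` this forces it to consist of pairs
(down-set, complement), adding one vertex at a time. The moment at which a vertex enters the chain
ranks the vertices, and left modularity makes this ranking an `IsOverlapRanking`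
(`exists_isOverlapRanking`).

Such a ranking gives every cover `p ⋖ q` a unique label, the only vertex of `q.X ∩ p.Y`. The labels
below `x` form an independent set that determines `x`, the labels above `x` form another, and
together they are tight (`mem_X_of_ne`, `rightPerp_downLabels`, `isTight_labels`). Every independent
set occurs as a set of lower labels, and a tight pair is determined by its first component, so `x ↦
(downLabels, upLabels)` is a bijection onto `top(G)`. Passing to the upper cover with label `g` is
exactly the flip at `g` (`flip_labels`); both orders are generated by these steps. -/

/-! ### Length of left modular maximal chains. -/

/-- In a left modular lattice, if `y < z` then some covering step `c' ⋖ c` of a maximal chain `C`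
separates `y` from `z`. -/
theorem IsMaxChain.exists_covBy_separating {α : Type*} [Lattice α] [BoundedOrder α] [Finite α]
    {C : Set α} (hC : IsMaxChain (· ≤ ·) C) {y z : α} (h : y < z) :
    ∃ c' ∈ C, ∃ c ∈ C, c' ⋖ c ∧ c' ⊓ z ≤ y ∧ ¬ c ⊓ z ≤ y := by
  obtain ⟨c, ⟨hc, hcz⟩, hmin⟩ := (Set.toFinite {c ∈ C | ¬ c ⊓ z ≤ y}).exists_minimal
    ⟨⊤, hC.top_mem, by simpa using not_le_of_gt h⟩
  have hc0 : ⊥ < c := bot_lt_iff_ne_bot.2 fun h0 => hcz (by simp [h0])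
  obtain ⟨c', ⟨hc', hlt⟩, hmax⟩ := (Set.toFinite {d ∈ C | d < c}).exists_maximal
    ⟨⊥, hC.bot_mem, hc0⟩
  refine ⟨c', hc', c, hc, ⟨hlt, fun w hw hwc => ?_⟩, ?_, hcz⟩
  · have hwC : w ∈ C := by
      have hch : IsChain (· ≤ ·) (insert w C) := by
        refine hC.1.insert fun d hd _ => ?_
        rcases hC.1.total hd hc with hdc | hdc
        · rcases hdc.eq_or_lt with rfl | hdc
          · exact Or.inl hwc.le
          · rcases hC.1.total hd hc' with h1 | h1
            · exact Or.inr (h1.trans hw.le)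
            · exact Or.inr ((hmax ⟨hd, hdc⟩ h1).trans hw.le)
        · exact Or.inl (hwc.le.trans hdc)
      rw [hC.2 hch (Set.subset_insert w C)]
      exact Set.mem_insert w C
    exact hw.not_ge (hmax ⟨hwC, hwc⟩ hw.le)
  · by_contra hn
    exact hlt.not_ge (hmin ⟨hc', hn⟩ hlt.le)

/-- A maximal chain of left modular elements is at least as long as every other chain. -/
theorem IsMaxChain.le_ncard_of_isLeftModular {α : Type*} [Lattice α] [BoundedOrder α] [Finite α]
    {C : Set α} (hC : IsMaxChain (· ≤ ·) C) (hm : ∀ x ∈ C, IsLeftModular x) {n : ℕ}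
    {p : Fin (n + 1) → α} (hp : StrictMono p) : n + 1 ≤ C.ncard := by
  have H : ∀ i : Fin n, _ := fun i =>
    hC.exists_covBy_separating (hp (Fin.castSucc_lt_succ (i := i)))
  choose c' hc' c hc hcov hle hnle using H
  -- One covering step of `C` cannot separate two steps of `p`: if it separates the earlier one,
  -- then `c ≤ c' ⊔ p j`, and left modularity of `c'` gives `c ⊓ p (j+1) ≤ p j`.
  have key : ∀ i j, i < j → c i ≠ c j := by
    intro i j hij h
    have h' : c' i = c' j := by
      rcases hC.1.total (hc' i) (hc' j) with h1 | h1
      · exact ((hcov i).eq_or_eq h1 (h ▸ (hcov j).le)).elim Eq.symm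
          fun h2 => absurd (h2.trans h) (hcov j).lt.ne
      · exact ((hcov j).eq_or_eq h1 (h ▸ (hcov i).le)).elim id
          fun h2 => absurd (h2.trans h.symm) (hcov i).lt.ne
    have hzy : p i.succ ≤ p j.castSucc := hp.monotone (Fin.succ_le_castSucc_iff.2 hij)
    have h1 : c i ≤ c' i ⊔ p i.succ := by
      rcases (hcov i).eq_or_eq (c := c' i ⊔ (c i ⊓ p i.succ)) le_sup_left
        (sup_le (hcov i).le inf_le_left) with h2 | h2
      · exact absurd ((le_inf (sup_eq_left.1 h2) inf_le_right).trans (hle i)) (hnle i)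
      · exact h2.ge.trans (sup_le_sup_left inf_le_right _)
    have h2 := hm _ (hc' j) (p j.castSucc) (p j.succ) (hp Fin.castSucc_lt_succ).le
    rw [sup_eq_left.2 (hle j)] at h2
    refine hnle j (le_trans (inf_le_inf_right _ ?_) h2.le)
    rw [← h, ← h', sup_comm]
    exact h1.trans (sup_le_sup_left hzy _)
  have hinj : Function.Injective c := by
    intro i j h
    by_contra hne
    rcases lt_or_gt_of_ne hne with h1 | h1
    · exact key i j h1 h
    · exact key j i h1 h.symm
  -- The bottom is never the upper end of a covering step, so it supplies the missing element of the
  -- count.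
  have hb : ⊥ ∉ Set.range c := by
    rintro ⟨i, hi⟩
    exact not_lt_bot (hi ▸ (hcov i).lt)
  have hcard : (insert ⊥ (Set.range c)).ncard = n + 1 := by
    rw [Set.ncard_insert_of_notMem hb, ← Set.image_univ, Set.ncard_image_of_injective _ hinj]
    simp
  rw [← hcard]
  exact Set.ncard_le_ncard (Set.insert_subset hC.bot_mem (Set.range_subset_iff.2 hc))

/-! ### Closures, bounds and finiteness of `𝓛(G)`. -/

namespace Digraph

variable {V : Type*} {G : Digraph V}

namespace Mop

/-- The least maximal orthogonal pair whose first component contains `A`. -/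
def closureX (G : Digraph V) (A : Set V) : Mop G where
  X := leftPerp G (rightPerp G A)
  Y := rightPerp G A
  maximal := maximal_of_eq (Set.Subset.antisymm right_left (rightPerp_anti left_right)) rfl

/-- The greatest maximal orthogonal pair whose second component contains `B`. -/
def closureY (G : Digraph V) (B : Set V) : Mop G where
  X := leftPerp G B
  Y := rightPerp G (leftPerp G B)
  maximal := maximal_of_eq rfl (Set.Subset.antisymm left_right (leftPerp_anti right_left))

/-- The maximal orthogonal pair formed by a down-closed set of vertices and its complement. -/
def ofIdeal (I : Set V) (h : ∀ a ∈ I, ∀ b, G.Adj a b → b ∈ I) : Mop G where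
  X := I
  Y := Iᶜ
  maximal := by
    refine maximal_of_eq ?_ ?_
    · ext v
      exact ⟨fun hv => ⟨hv, fun x hx hxv => hv (h x hx v hxv)⟩, fun hv => hv.1⟩
    · ext v
      exact ⟨fun hv => ⟨fun hn => hn hv, fun y hy hvy => hy (h v hv y hvy)⟩,
        fun hv => not_not.1 hv.1⟩

instance : BoundedOrder (Mop G) where
  bot := closureX G ∅
  top := closureY G ∅
  bot_le _ := le_iff_Y.2 fun _ _ => ⟨fun h => h, fun _ h => h.elim⟩
  le_top _ := le_def.2 fun _ _ => ⟨fun h => h, fun _ h => h.elim⟩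

theorem eq_of_X_eq {p q : Mop G} (h : p.X = q.X) : p = q :=
  le_antisymm h.subset h.superset

theorem X_injective : Function.Injective (Mop.X : Mop G → Set V) := fun _ _ => eq_of_X_eq

theorem Y_injective : Function.Injective (Mop.Y : Mop G → Set V) := fun _ _ h =>
  le_antisymm (le_iff_Y.2 h.superset) (le_iff_Y.2 h.subset)

instance [Finite V] : Finite (Mop G) := Finite.of_injective _ X_injective

theorem isOrthogonal (p : Mop G) : G.IsOrthogonal p.X p.Y := p.maximal.prop

theorem notMem_Y_of_mem_X (p : Mop G) {v : V} (h : v ∈ p.X) : v ∉ p.Y :=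
  Set.disjoint_left.1 p.isOrthogonal.1 h

theorem not_adj (p : Mop G) {a b : V} (ha : a ∈ p.X) (hb : b ∈ p.Y) : ¬ G.Adj a b :=
  p.isOrthogonal.2 a ha b hb

theorem ncard_X_strictMono [Finite V] : StrictMono fun p : Mop G => p.X.ncard := fun _ _ h =>
  Set.ncard_lt_ncard ((le_def.1 h.le).ssubset_of_ne fun e => h.ne (X_injective e))

theorem ncard_Y_strictAnti [Finite V] : StrictAnti fun p : Mop G => p.Y.ncard := fun _ _ h =>
  Set.ncard_lt_ncard ((le_iff_Y.1 h.le).ssubset_of_ne fun e => h.ne' (Y_injective e))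

end Mop

/-! ### From a left modular chain to a ranking of the vertices. -/

/-- An injective ranking of the vertices, increasing along `G`-order, such that whenever `p < q` in
`𝓛(G)` the lowest vertex that `q` has in excess of `p` in the first component, and the highest
vertex that `p` has in excess of `q` in the second component, both lie in `q.X ∩ p.Y`. -/
structure IsOverlapRanking (G : Digraph V) (r : V → ℤ) : Prop where
  lt_of_adj : ∀ a b, G.Adj a b → r b < r a
  injective : Function.Injective r
  exists_min : ∀ p q : Mop G, p < q → ∃ g ∈ q.X ∩ p.Y, ∀ h ∈ q.X \ p.X, r g ≤ r h
  exists_max : ∀ p q : Mop G, p < q → ∃ g ∈ q.X ∩ p.Y, ∀ h ∈ p.Y \ q.Y, r h ≤ r g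

/-- A maximal chain of left modular elements of `𝓛(G)` consists of down-closed sets of vertices,
one of every cardinality. -/
theorem Mop.isMaxChain_levels {n : ℕ} (e : Fin n ≃ V) (he : ∀ i j, i < j → ¬ G.Adj (e i) (e j))
    {C : Set (Mop G)} (hC : IsMaxChain (· ≤ ·) C)
    (hm : ∀ x ∈ C, IsLeftModular x) :
    (∀ i ≤ n, ∃ c ∈ C, c.X.ncard = i) ∧ ∀ c ∈ C, c.Y = c.Xᶜ := by
  have : Finite V := Finite.of_equiv _ e
  have hn : Nat.card V = n := by simpa using (Nat.card_congr e).symm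
  have hp : StrictMono fun i : Fin (n + 1) => Mop.ofIdeal (G := G) {v | (e.symm v : ℕ) < i}
      (fun a ha b hab => by
        by_contra hb
        simp only [Set.mem_ofPred_eq, not_lt] at ha hb
        exact he (e.symm a) (e.symm b) (Fin.lt_def.2 (ha.trans_le hb)) (by simpa using hab)) := by
    intro i j hij
    have hin : (i : ℕ) < n := lt_of_lt_of_le (Fin.lt_def.1 hij) (Nat.lt_succ_iff.1 j.2)
    refine lt_of_le_of_ne (fun v (hv : _ < _) => show _ < _ from hv.trans (Fin.lt_def.1 hij)) ?_
    intro h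
    have h1 : e ⟨i, hin⟩ ∈ {v | (e.symm v : ℕ) < j} := by simpa using Fin.lt_def.1 hij
    have h2 : e ⟨i, hin⟩ ∈ {v | (e.symm v : ℕ) < i} := by
      rw [← show _ = {v | (e.symm v : ℕ) < j} from congrArg Mop.X h] at h1
      exact h1
    simp at h2
  have hcard : n + 1 ≤ C.ncard := hC.le_ncard_of_isLeftModular hm hp
  have hXinj : Set.InjOn (fun p : Mop G => p.X.ncard) C := fun a ha b hb hab => by
    by_contra hne
    rcases hC.1.total ha hb with h | h
    · exact (ncard_X_strictMono (h.lt_of_ne hne)).ne hab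
    · exact (ncard_X_strictMono (h.lt_of_ne' hne)).ne' hab
  have hYinj : Set.InjOn (fun p : Mop G => p.Y.ncard) C := fun a ha b hb hab => by
    by_contra hne
    rcases hC.1.total ha hb with h | h
    · exact (ncard_Y_strictAnti (h.lt_of_ne hne)).ne' hab
    · exact (ncard_Y_strictAnti (h.lt_of_ne' hne)).ne hab
  constructor
  · have him : (fun p : Mop G => p.X.ncard) '' C = Set.Iic n := by
      refine Set.eq_of_subset_of_ncard_le ?_ ?_
      · rintro _ ⟨c, -, rfl⟩
        exact (Set.ncard_le_card _).trans hn.le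
      · rw [hXinj.ncard_image]
        simpa [Set.ncard_eq_toFinset_card'] using hcard
    intro i hi
    exact (him ▸ hi : i ∈ (fun p : Mop G => p.X.ncard) '' C)
  · intro c hc
    -- Counting `C` below and above `c` gives `n + 1 ≤ |X| + 1 + |Y|`; as `X` and `Y` are disjoint,
    -- they are complementary.
    have h1 : {d ∈ C | d ≤ c}.ncard ≤ c.X.ncard + 1 := by
      rw [← (hXinj.mono (Set.sep_subset _ _)).ncard_image]
      refine (Set.ncard_le_ncard (t := Set.Iic c.X.ncard) ?_).trans
        (by simp [Set.ncard_eq_toFinset_card'])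
      rintro _ ⟨d, hd, rfl⟩
      exact ncard_X_strictMono.monotone hd.2
    have h2 : {d ∈ C | c < d}.ncard ≤ c.Y.ncard := by
      rw [← (hYinj.mono (Set.sep_subset _ _)).ncard_image]
      refine (Set.ncard_le_ncard (t := Set.Iio c.Y.ncard) ?_).trans
        (by simp [Set.ncard_eq_toFinset_card'])
      rintro _ ⟨d, hd, rfl⟩
      exact ncard_Y_strictAnti hd.2
    have h3 : C = {d ∈ C | d ≤ c} ∪ {d ∈ C | c < d} := by
      ext d
      constructor
      · intro hd
        rcases hC.1.total hd hc with h | h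
        · exact Or.inl ⟨hd, h⟩
        · rcases h.eq_or_lt with h | h
          · exact Or.inl ⟨hd, h.ge⟩
          · exact Or.inr ⟨hd, h⟩
      · rintro (h | h) <;> exact h.1
    have h4 : C.ncard ≤ {d ∈ C | d ≤ c}.ncard + {d ∈ C | c < d}.ncard := by
      conv_lhs => rw [h3]
      exact Set.ncard_union_le _ _
    refine Set.eq_of_subset_of_ncard_le (fun y hy hx => c.notMem_Y_of_mem_X hx hy) ?_
    have h5 := Set.ncard_add_ncard_compl c.X
    omega

/-- The rank of `g` is the size of the first member `c` of the chain containing `g`; its predecessor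
`c'` in the chain lacks only `g`. If an extremal `g` were outside the overlap, left modularity of
`c'` (for the minimum) or of `c` (for the maximum) would contradict the choice of `g`. -/
theorem exists_isOverlapRanking {n : ℕ} (e : Fin n ≃ V)
    (he : ∀ i j, i < j → ¬ G.Adj (e i) (e j)) (hG : ∀ v, ¬ G.Adj v v)
    (hL : IsLeftModularLattice (Mop G)) : ∃ r : V → ℤ, G.IsOverlapRanking r := by
  have : Finite V := Finite.of_equiv _ e
  have hn : Nat.card V = n := by simpa using (Nat.card_congr e).symm
  obtain ⟨C, hC, hm⟩ := hL
  obtain ⟨hlev, hcompl⟩ := Mop.isMaxChain_levels e he hC hm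
  have hne : ∀ g : V, {i | ∃ c ∈ C, c.X.ncard = i ∧ g ∈ c.X}.Nonempty := fun g => by
    refine ⟨_, ⊤, hC.top_mem, rfl, ?_⟩
    exact ⟨fun h => h, fun _ h => h.elim⟩
  set r : V → ℕ := fun g => sInf {i | ∃ c ∈ C, c.X.ncard = i ∧ g ∈ c.X} with hr
  have hmem : ∀ c ∈ C, ∀ g, g ∈ c.X ↔ r g ≤ c.X.ncard := by
    intro c hc g
    refine ⟨fun h => Nat.sInf_le ⟨c, hc, rfl, h⟩, fun h => ?_⟩
    obtain ⟨d, hd, hdr, hdg⟩ := Nat.sInf_mem (hne g)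
    rcases hC.1.total hd hc with h1 | h1
    · exact h1 hdg
    · rcases h1.eq_or_lt with rfl | h1
      · exact hdg
      · exact absurd (Mop.ncard_X_strictMono h1) (by simp only [hdr]; exact not_lt.2 h)
  have hpos : ∀ g, 1 ≤ r g := fun g => by
    obtain ⟨d, hd, hdr, hdg⟩ := Nat.sInf_mem (hne g)
    rw [hr]; simp only; rw [← hdr]
    exact (Set.ncard_pos).2 ⟨g, hdg⟩
  have hstep : ∀ g, ∃ c' ∈ C, ∃ c ∈ C, c'.X.ncard + 1 = r g ∧ c.X.ncard = r g := fun g => by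
    obtain ⟨d, hd, hdr, -⟩ := Nat.sInf_mem (hne g)
    have hle : r g ≤ n := by
      have := Set.ncard_le_card d.X
      rw [hn, hdr] at this
      exact this
    obtain ⟨c', hc', h'⟩ := hlev (r g - 1) (by omega)
    exact ⟨c', hc', d, hd, by have := hpos g; omega, hdr⟩
  have hinj : Function.Injective r := by
    intro a b hab
    obtain ⟨c', hc', c, hc, h', h⟩ := hstep a
    by_contra hne
    have h1 : insert a (insert b c'.X) ⊆ c.X := by
      refine Set.insert_subset ((hmem c hc a).2 h.ge)
        (Set.insert_subset ((hmem c hc b).2 (hab ▸ h.ge)) fun v hv => ?_)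
      have := (hmem c' hc' v).1 hv
      exact (hmem c hc v).2 (by omega)
    have hb : b ∉ c'.X := fun hb => by
      have := (hmem c' hc' b).1 hb
      omega
    have ha : a ∉ insert b c'.X := by
      rintro (ha | ha)
      · exact hne ha
      · have := (hmem c' hc' a).1 ha
        omega
    have := Set.ncard_le_ncard h1
    rw [Set.ncard_insert_of_notMem ha, Set.ncard_insert_of_notMem hb] at this
    omega
  refine ⟨fun v => r v, ⟨fun a b hab => ?_, fun a b h => hinj (by exact_mod_cast h),
    fun p q hpq => ?_, fun p q hpq => ?_⟩⟩
  · obtain ⟨-, -, c, hc, -, h⟩ := hstep a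
    have ha : a ∈ c.X := (hmem c hc a).2 h.ge
    have hb : b ∈ c.X := by
      by_contra hb
      exact c.not_adj ha (by rw [hcompl c hc]; exact hb) hab
    have h1 := (hmem c hc b).1 hb
    rw [h] at h1
    have h2 : r b ≠ r a := fun h2 => hG a (by rwa [hinj h2] at hab)
    have : r b < r a := lt_of_le_of_ne h1 h2
    exact_mod_cast this
  · have hne' : (q.X \ p.X).Nonempty := Set.sdiff_nonempty.2 fun h => hpq.not_ge h
    obtain ⟨g, hg, hmin⟩ := Set.exists_min_image (q.X \ p.X) r (Set.toFinite _) hne'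
    refine ⟨g, ⟨hg.1, ?_⟩, fun h hh => by exact_mod_cast hmin h hh⟩
    by_contra hgY
    obtain ⟨c', hc', c, hc, h', h⟩ := hstep g
    have h1 : c' ⊓ q ≤ p := by
      rintro v ⟨hv, hvq⟩
      by_contra hvp
      have h2 := hmin v ⟨hvq, hvp⟩
      have h3 := (hmem c' hc' v).1 hv
      omega
    -- The second components of `c` and `c'` differ only in `g`, which `p.Y` is assumed to avoid.
    have h2 : p ⊔ c ≤ p ⊔ c' := by
      refine Mop.le_iff_Y.2 ?_
      rintro v ⟨hvp, hvc⟩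
      refine ⟨hvp, ?_⟩
      rw [hcompl c hc, Set.mem_compl_iff, hmem c hc]
      rw [hcompl c' hc', Set.mem_compl_iff, hmem c' hc'] at hvc
      have : r v ≠ r g := fun e => hgY (hinj e ▸ hvp)
      omega
    have h3 := hm c' hc' p q hpq.le
    rw [sup_eq_left.2 h1] at h3
    have h4 : c ⊓ q ≤ p := (inf_le_inf_right q (le_sup_right.trans h2)).trans h3.le
    exact hg.2 (h4 ⟨(hmem c hc g).2 h.ge, hg.1⟩)
  · have hne' : (p.Y \ q.Y).Nonempty :=
      Set.sdiff_nonempty.2 fun h => hpq.not_ge (Mop.le_iff_Y.2 h)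
    obtain ⟨g, hg, hmax⟩ := Set.exists_max_image (p.Y \ q.Y) r (Set.toFinite _) hne'
    refine ⟨g, ⟨?_, hg.1⟩, fun h hh => by exact_mod_cast hmax h hh⟩
    by_contra hgX
    obtain ⟨c', hc', c, hc, h', h⟩ := hstep g
    have h1 : c ⊓ q ≤ c' := by
      rintro v ⟨hv, hvq⟩
      have h2 := (hmem c hc v).1 hv
      have : r v ≠ r g := fun e => hgX (hinj e ▸ hvq)
      exact (hmem c' hc' v).2 (by omega)
    -- Vertices of `p.Y` outside `c` outrank `g`, so by maximality of `g` they lie in `q.Y`.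
    have h2 : q ≤ p ⊔ c := by
      refine Mop.le_iff_Y.2 ?_
      rintro v ⟨hvp, hvc⟩
      by_contra hvq
      have h2 := hmax v ⟨hvp, hvq⟩
      rw [hcompl c hc, Set.mem_compl_iff, hmem c hc] at hvc
      omega
    have h3 := hm c hc p q hpq.le
    rw [inf_eq_right.2 h2] at h3
    have h4 : q ≤ p ⊔ c' := h3.le.trans (sup_le_sup_left h1 p)
    refine hg.2 (Mop.le_iff_Y.1 h4 ⟨hg.1, ?_⟩)
    rw [hcompl c' hc', Set.mem_compl_iff, hmem c' hc']
    omega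

/-! ### Duality and labels of covers. -/

/-- The digraph with all edges reversed. -/
def op (G : Digraph V) : Digraph V := ⟨fun a b => G.Adj b a⟩

theorem op_geq {a b : V} : G.op.Geq a b ↔ G.Geq b a := reflTransGen_swap

namespace Mop

/-- Exchanging the two components of maximal orthogonal pairs. -/
def opIso (G : Digraph V) : Mop G ≃o (Mop G.op)ᵒᵈ where
  toFun p := OrderDual.toDual ⟨p.Y, p.X, maximal_of_eq p.X_eq p.Y_eq⟩
  invFun p := ⟨p.ofDual.Y, p.ofDual.X, maximal_of_eq p.ofDual.X_eq p.ofDual.Y_eq⟩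
  left_inv _ := rfl
  right_inv _ := rfl
  map_rel_iff' := le_iff_Y.symm

/-- The maximal orthogonal pair of the reversed digraph with the components exchanged. -/
def op (p : Mop G) : Mop G.op := (opIso G p).ofDual

theorem op_covBy_op {p q : Mop G} : q.op ⋖ p.op ↔ p ⋖ q :=
  ofDual_covBy_ofDual_iff.trans (apply_covBy_apply_iff (opIso G))

theorem op_lt_op {p q : Mop G} : q.op < p.op ↔ p < q := (opIso G).lt_iff_lt

theorem op_surjective : Function.Surjective (op : Mop G → Mop G.op) := fun p =>
  ⟨(opIso G).symm (OrderDual.toDual p), rfl⟩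

/-- The labels of the lower covers of `x`. -/
def downLabels (x : Mop G) : Set V := {g | g ∈ x.X ∧ ∃ p, p ⋖ x ∧ g ∈ p.Y}

/-- The labels of the upper covers of `x`. -/
def upLabels (x : Mop G) : Set V := {g | g ∈ x.Y ∧ ∃ q, x ⋖ q ∧ g ∈ q.X}

theorem downLabels_op (x : Mop G) : x.op.downLabels = x.upLabels := by
  ext g
  refine and_congr_right fun _ => ⟨?_, ?_⟩
  · rintro ⟨p, hp, hg⟩
    obtain ⟨q, rfl⟩ := op_surjective p
    exact ⟨q, op_covBy_op.1 hp, hg⟩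
  · rintro ⟨q, hq, hg⟩
    exact ⟨q.op, op_covBy_op.2 hq, hg⟩

theorem upLabels_op (x : Mop G) : x.op.upLabels = x.downLabels := by
  ext g
  refine and_congr_right fun _ => ⟨?_, ?_⟩
  · rintro ⟨p, hp, hg⟩
    obtain ⟨q, rfl⟩ := op_surjective p
    exact ⟨q, op_covBy_op.1 hp, hg⟩
  · rintro ⟨q, hq, hg⟩
    exact ⟨q.op, op_covBy_op.2 hq, hg⟩

theorem downLabels_subset (x : Mop G) : x.downLabels ⊆ x.X := fun _ h => h.1

theorem upLabels_subset (x : Mop G) : x.upLabels ⊆ x.Y := fun _ h => h.1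

end Mop

open Mop

namespace IsOverlapRanking

variable {r : V → ℤ}

/-- Negating ranks exchanges the minimum and maximum conditions, so each result on lower labels
yields its dual on upper labels. -/
theorem op (hr : G.IsOverlapRanking r) : G.op.IsOverlapRanking fun v => - r v where
  lt_of_adj a b h := neg_lt_neg (hr.lt_of_adj b a h)
  injective := neg_injective.comp hr.injective
  exists_min p q hpq := by
    obtain ⟨p, rfl⟩ := op_surjective p
    obtain ⟨q, rfl⟩ := op_surjective q
    obtain ⟨g, hg, h⟩ := hr.exists_max q p (op_lt_op.1 hpq)
    exact ⟨g, hg.symm, fun k hk => neg_le_neg (h k hk)⟩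
  exists_max p q hpq := by
    obtain ⟨p, rfl⟩ := op_surjective p
    obtain ⟨q, rfl⟩ := op_surjective q
    obtain ⟨g, hg, h⟩ := hr.exists_min q p (op_lt_op.1 hpq)
    exact ⟨g, hg.symm, fun k hk => neg_le_neg (h k hk)⟩

theorem irrefl (hr : G.IsOverlapRanking r) (v : V) : ¬ G.Adj v v := fun h =>
  (hr.lt_of_adj v v h).false

theorem le_of_geq (hr : G.IsOverlapRanking r) {a b : V} (h : G.Geq a b) : r b ≤ r a := by
  induction h with
  | refl => exact le_rfl
  | tail _ h ih => exact (hr.lt_of_adj _ _ h).le.trans ih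

theorem exists_mem (hr : G.IsOverlapRanking r) {p q : Mop G} (h : p < q) :
    ∃ g, g ∈ q.X ∧ g ∈ p.Y :=
  (hr.exists_min p q h).imp fun _ h => h.1

/-- Without an edge `g → k`, the meet of `q` with `closureY G {k}` would be strictly between `p` and
`q`: it contains `g` and omits `k`. By symmetry two distinct labels would form a 2-cycle. -/
theorem label_unique_aux {p q : Mop G} (h : p ⋖ q) {g k : V} (hg : g ∈ q.X)
    (hg' : g ∈ p.Y) (hk : k ∈ q.X) (hk' : k ∈ p.Y) (hgk : g ≠ k) : G.Adj g k := by
  by_contra hn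
  have h1 : p ≤ q ⊓ closureY G {k} := le_inf h.le fun v hv =>
    ⟨fun (e : v = k) => p.notMem_Y_of_mem_X hv (e ▸ hk'),
      fun y (e : y = k) => e ▸ p.not_adj hv hk'⟩
  have hgm : g ∈ (q ⊓ closureY G {k}).X :=
    ⟨hg, hgk, fun y (e : y = k) => e ▸ hn⟩
  rcases h.eq_or_eq h1 inf_le_left with h2 | h2
  · rw [h2] at hgm
    exact p.notMem_Y_of_mem_X hgm hg'
  · exact ((inf_eq_left.1 h2) hk).1 rfl

theorem label_unique (hr : G.IsOverlapRanking r) {p q : Mop G} (h : p ⋖ q) {g k : V}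
    (hg : g ∈ q.X) (hg' : g ∈ p.Y) (hk : k ∈ q.X) (hk' : k ∈ p.Y) : g = k := by
  by_contra hne
  exact (hr.lt_of_adj _ _ (label_unique_aux h hg hg' hk hk' hne)).not_gt
    (hr.lt_of_adj _ _ (label_unique_aux h hk hk' hg hg' (Ne.symm hne)))

/-- A label of a lower cover of `x` belongs to every other lower cover of `x`. -/
theorem mem_X_of_ne (hr : G.IsOverlapRanking r) {x p p' : Mop G} (hp : p ⋖ x) (hp' : p' ⋖ x)
    {d d' : V} (hd : d ∈ x.X) (hdp : d ∈ p.Y) (hd' : d' ∈ x.X) (hdp' : d' ∈ p'.Y)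
    (hne : d ≠ d') : d ∈ p'.X := by
  by_contra hdX
  have hpp : ¬ p ≤ p' := fun h => by
    rcases hp.eq_or_eq h hp'.le with h1 | h1
    · exact hne (hr.label_unique hp hd hdp hd' (h1 ▸ hdp'))
    · exact hp'.lt.ne h1
  have hpp' : ¬ p' ≤ p := fun h => by
    rcases hp'.eq_or_eq h hp.le with h1 | h1
    · exact hne (hr.label_unique hp hd hdp hd' (h1 ▸ hdp'))
    · exact hp.lt.ne h1
  have hlt : r d' < r d := by
    obtain ⟨g, hg, hmin⟩ := hr.exists_min p' x hp'.lt
    rw [hr.label_unique hp' hg.1 hg.2 hd' hdp'] at hmin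
    exact lt_of_le_of_ne (hmin d ⟨hd, hdX⟩) fun e => hne (hr.injective e.symm)
  have hmY : ∀ {v}, v ∈ p.Y → v ∈ (p ⊓ p').Y := fun h => le_iff_Y.1 inf_le_left h
  -- The highest vertex `f` lost from the second component between `p ⊓ p'` and `x` will turn out to
  -- lie in both `p.X` and `p'.X`, hence in both components of `p ⊓ p'`.
  obtain ⟨f, ⟨hfx, hfm⟩, hmax⟩ := hr.exists_max (p ⊓ p') x (inf_le_left.trans_lt hp.lt)
  have hxY : ∀ z : Mop G, z ≤ x → ∀ v, v ∉ z.Y → v ∉ x.Y := fun z hz v hv h =>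
    hv (le_iff_Y.1 hz h)
  have hdf : r d ≤ r f := hmax d ⟨hmY hdp, x.notMem_Y_of_mem_X hd⟩
  have main : ∀ z : Mop G, z ≤ x → p ⊓ p' < z → f ∉ z.Y → f ∈ z.X := by
    intro z hz hlt hf
    obtain ⟨g, hg, hgmax⟩ := hr.exists_max (p ⊓ p') z hlt
    have h1 := hgmax f ⟨hfm, hf⟩
    have h2 := hmax g ⟨hg.2, hxY z hz g (z.notMem_Y_of_mem_X hg.1)⟩
    rw [hr.injective (le_antisymm h1 h2)]
    exact hg.1
  have hfp' : f ∈ p'.X := main p' hp'.le (inf_lt_right.2 hpp') fun h => by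
    rw [hr.label_unique hp' hfx h hd' hdp'] at hdf
    exact hlt.not_ge hdf
  have hfd : f ≠ d := fun h => hdX (h ▸ hfp')
  have hfp : f ∈ p.X := main p hp.le (inf_lt_left.2 hpp) fun h =>
    hfd (hr.label_unique hp hfx h hd hdp)
  exact (p ⊓ p').notMem_Y_of_mem_X ⟨hfp, hfp'⟩ hfm

theorem isIndependent_downLabels (hr : G.IsOverlapRanking r) (x : Mop G) :
    G.IsIndependent x.downLabels := by
  rintro d ⟨hd, p, hp, hdp⟩ d' ⟨hd', p', hp', hdp'⟩ hadj
  have hne : d ≠ d' := fun h => hr.irrefl d' (h ▸ hadj)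
  exact p'.not_adj (hr.mem_X_of_ne hp hp' hd hdp hd' hdp' hne) hdp' hadj

theorem isIndependent_upLabels (hr : G.IsOverlapRanking r) (x : Mop G) :
    G.IsIndependent x.upLabels := fun a ha b hb h => by
  rw [← downLabels_op] at ha hb
  exact hr.op.isIndependent_downLabels x.op b hb a ha h

/-- If the closure of the labels were strictly below `x`, it would lie below some lower cover `p`,
whose label would then be in both `p.X` and `p.Y`. -/
theorem rightPerp_downLabels [Finite V] (hr : G.IsOverlapRanking r) (x : Mop G) :
    rightPerp G x.downLabels = x.Y := by
  suffices h : closureX G x.downLabels = x from congrArg Mop.Y h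
  have hle : closureX G x.downLabels ≤ x := le_iff_Y.2 <| by
    conv_lhs => rw [x.Y_eq]
    exact rightPerp_anti x.downLabels_subset
  by_contra hne
  obtain ⟨p, hzp, hp⟩ := exists_le_covBy_of_lt (lt_of_le_of_ne hle hne)
  obtain ⟨d, hd, hdp⟩ := hr.exists_mem hp.lt
  exact p.notMem_Y_of_mem_X (hzp (left_right (show d ∈ x.downLabels from ⟨hd, p, hp, hdp⟩))) hdp

theorem leftPerp_upLabels [Finite V] (hr : G.IsOverlapRanking r) (x : Mop G) :
    leftPerp G x.upLabels = x.X := by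
  rw [← downLabels_op]
  exact hr.op.rightPerp_downLabels x.op

theorem downLabels_injective [Finite V] (hr : G.IsOverlapRanking r) :
    Function.Injective (downLabels : Mop G → Set V) := fun x y h =>
  Y_injective (by rw [← hr.rightPerp_downLabels, h, hr.rightPerp_downLabels])

/-! ### Label pairs are exactly the tight pairs. -/

/-- A new `k` orthogonal to the upper labels lies in `x.X`, hence not in `x.Y`, so some lower label
`d` has an edge to `k`. Keeping `d` breaks independence, and replacing it by a larger `k`
contradicts the edge. The other side is dual. -/
theorem isTight_labels [Finite V] (hr : G.IsOverlapRanking r) (x : Mop G) :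
    G.IsTight x.downLabels x.upLabels := by
  have hl : ∀ D k, G.IsOrthIndep (insert k D) x.upLabels → k ∉ x.downLabels →
      ∃ d ∈ x.downLabels, G.Adj d k := by
    intro D k hk hkD
    have hX : k ∈ x.X := by
      rw [← hr.leftPerp_upLabels x]
      exact orth_iff_left.1 hk.2.2 (Set.mem_insert k D)
    by_contra! hn
    refine x.notMem_Y_of_mem_X hX ?_
    rw [← hr.rightPerp_downLabels x]
    exact ⟨hkD, hn⟩
  have hu : ∀ U k, G.IsOrthIndep x.downLabels (insert k U) → k ∉ x.upLabels →
      ∃ u ∈ x.upLabels, G.Adj k u := by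
    intro U k hk hkU
    have hY : k ∈ x.Y := by
      rw [← hr.rightPerp_downLabels x]
      exact orth_iff_right.1 hk.2.2 (Set.mem_insert k U)
    by_contra! hn
    refine x.notMem_Y_of_mem_X ?_ hY
    rw [← hr.leftPerp_upLabels x]
    exact ⟨hkU, hn⟩
  refine ⟨⟨hr.isIndependent_downLabels x, hr.isIndependent_upLabels x, ?_, ?_⟩, ?_, ?_, ?_, ?_⟩
  · exact x.isOrthogonal.1.mono x.downLabels_subset x.upLabels_subset
  · exact fun a ha b hb => x.not_adj ha.1 hb.1
  · intro k hk h
    obtain ⟨d, hd, hdk⟩ := hl _ k h hk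
    exact h.1 d (Or.inr hd) k (Or.inl rfl) hdk
  · intro k hk h
    obtain ⟨u, hu, hku⟩ := hu _ k h hk
    exact h.2.1 k (Or.inl rfl) u (Or.inr hu) hku
  · intro S hS _ k hk hge h
    obtain ⟨d, hd, hdk⟩ := hl _ k h hk
    by_cases hdS : d ∈ S
    · exact (hr.le_of_geq (hge d hdS)).not_gt (hr.lt_of_adj _ _ hdk)
    · exact h.1 d (Or.inr ⟨hd, hdS⟩) k (Or.inl rfl) hdk
  · intro S hS _ k hk hge h
    obtain ⟨u, hu, hku⟩ := hu _ k h hk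
    by_cases huS : u ∈ S
    · exact (hr.le_of_geq (hge u huS)).not_gt (hr.lt_of_adj _ _ hku)
    · exact h.2.1 k (Or.inl rfl) u (Or.inr ⟨hu, huS⟩) hku

theorem wellFounded [Finite V] (r : V → ℤ) : WellFounded fun a b : V => r a < r b :=
  haveI : IsTrans V fun a b => r a < r b := ⟨fun _ _ _ => lt_trans⟩
  haveI : Std.Irrefl fun a b : V => r a < r b := ⟨fun _ => lt_irrefl _⟩
  Finite.wellFounded_of_trans_of_irrefl _

/-- Every independent set is the set of labels of the lower covers of some element. -/
theorem exists_downLabels_eq [Finite V] (hr : G.IsOverlapRanking r) {D : Set V}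
    (hD : G.IsIndependent D) : ∃ x : Mop G, x.downLabels = D := by
  have hDX : D ⊆ (closureX G D).X := left_right
  have hsub : D ⊆ (closureX G D).downLabels := by
    intro d hd
    -- A lower cover above this meet must have label `d`: any other label `e` would be forced to
    -- have an edge `d → e`, hence none back, and so to lie in the meet.
    have hlt : closureX G D ⊓ closureY G {d} < closureX G D :=
      inf_lt_left.2 fun h => (h (hDX hd)).1 rfl
    obtain ⟨p, hzp, hp⟩ := exists_le_covBy_of_lt hlt
    refine ⟨hDX hd, p, hp, ?_⟩
    obtain ⟨e, heX, hep⟩ := hr.exists_mem hp.lt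
    suffices e = d from this ▸ hep
    by_contra hne
    have hed : G.Adj d e := by
      by_contra hn
      refine (closureX G D).notMem_Y_of_mem_X heX ⟨fun heD => ?_, fun c hc hce => ?_⟩
      · refine p.notMem_Y_of_mem_X (hzp ⟨hDX heD, hne, ?_⟩) hep
        rintro y rfl
        exact hD e heD y hd
      · rcases eq_or_ne c d with rfl | hcd
        · exact hn hce
        · refine p.not_adj (hzp ⟨hDX hc, hcd, ?_⟩) hep hce
          rintro y rfl
          exact hD c hc y hd
    refine p.notMem_Y_of_mem_X (hzp ⟨heX, hne, ?_⟩) hep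
    rintro y rfl h
    exact (hr.lt_of_adj _ _ h).not_gt (hr.lt_of_adj _ _ hed)
  refine ⟨closureX G D, Set.Subset.antisymm (fun e he => ?_) hsub⟩
  by_contra heD
  exact (closureX G D).notMem_Y_of_mem_X he.1
    ⟨heD, fun d hd => hr.isIndependent_downLabels _ d (hsub hd) e he⟩

/-- The second component of a tight orthogonal pair is determined by the first. -/
theorem mem_iff_of_isTight [Finite V] (hr : G.IsOverlapRanking r) {D U U' : Set V}
    (h : G.IsTight D U) (h' : G.IsTight D U') (k : V) : k ∈ U ↔ k ∈ U' := by
  induction k using (wellFounded r).induction with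
  | _ k ih =>
    have aux : ∀ {U U' : Set V}, G.IsTight D U → G.IsTight D U' →
        (∀ j, r j < r k → (j ∈ U ↔ j ∈ U')) → k ∈ U → k ∈ U' := by
      intro U U' h h' ih hk
      by_contra hk'
      -- By induction `U` and `U'` agree below `k`, so only elements with an edge to `k` obstruct
      -- adding `k` to `U'`; exchanging them for `k` is a forbidden decrease.
      have hup : ∀ u ∈ U', ¬ G.Adj k u := fun u hu hadj =>
        h.orthIndep.2.1 k hk u ((ih u (hr.lt_of_adj _ _ hadj)).2 hu) hadj
      have hO : G.IsOrthIndep D (insert k (U' \ {u ∈ U' | G.Adj u k})) := by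
        refine ⟨h.orthIndep.1, ?_, ?_⟩
        · rintro a (rfl | ha) b (rfl | hb)
          · exact hr.irrefl _
          · exact hup b hb.1
          · exact fun hab => ha.2 ⟨ha.1, hab⟩
          · exact h'.orthIndep.2.1 a ha.1 b hb.1
        · rw [orth_iff_right]
          refine Set.insert_subset (orth_iff_right.1 h.orthIndep.2.2 hk)
            (Set.sdiff_subset.trans (orth_iff_right.1 h'.orthIndep.2.2))
      rcases Set.eq_empty_or_nonempty {u ∈ U' | G.Adj u k} with he | hne
      · rw [he, Set.sdiff_empty] at hO
        exact h'.not_insert_right k hk' hO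
      · exact h'.not_decrease _ (Set.sep_subset _ _) hne k hk'
          (fun u hu => ReflTransGen.single hu.2) hO
    exact ⟨aux h h' ih, aux h' h fun j hj => (ih j hj).symm⟩

/-- Since ranks drop along edges, this determines the upper labels recursively from `x.Y`, starting
with the lowest vertices. -/
theorem mem_upLabels_iff [Finite V] (hr : G.IsOverlapRanking r) {x : Mop G} {k : V} :
    k ∈ x.upLabels ↔ k ∈ x.Y ∧ ∀ u ∈ x.upLabels, ¬ G.Adj k u := by
  refine ⟨fun h => ⟨h.1, fun u hu => hr.isIndependent_upLabels x k h u hu⟩, fun h => ?_⟩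
  by_contra hk
  refine x.notMem_Y_of_mem_X ?_ h.1
  rw [← hr.leftPerp_upLabels x]
  exact ⟨hk, h.2⟩

/-! ### Upper covers are flips. -/

/-- Passing to an upper cover with label `g` changes the upper labels only above `g`. -/
theorem mem_upLabels_congr [Finite V] (hr : G.IsOverlapRanking r) {x y : Mop G} (hxy : x ⋖ y)
    {g : V} (hgy : g ∈ y.X) (hgx : g ∈ x.Y) (k : V) (hk : ¬ G.Geq k g) :
    k ∈ x.upLabels ↔ k ∈ y.upLabels := by
  induction k using (wellFounded r).induction with
  | _ k ih =>
    have ih' : ∀ u, G.Adj k u → (u ∈ x.upLabels ↔ u ∈ y.upLabels) := fun u hku =>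
      ih u (hr.lt_of_adj _ _ hku) fun h => hk (ReflTransGen.head hku h)
    constructor
    · intro h
      refine hr.mem_upLabels_iff.2 ⟨?_, fun u hu hku =>
        hr.isIndependent_upLabels x k h u ((ih' u hku).2 hu) hku⟩
      rw [← hr.rightPerp_downLabels y]
      -- As `x` is itself a lower cover of `y`, the other lower labels of `y` are in `x.X`, hence
      -- orthogonal to `k`; the label `g` has no edge to `k` because both are upper labels of `x`.
      have hne : ∀ d ∈ y.downLabels, d ≠ g → d ∈ x.X := by
        rintro d ⟨hd, p, hp, hdp⟩ hdg
        exact hr.mem_X_of_ne hp hxy hd hdp hgy hgx hdg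
      refine ⟨fun hd => ?_, fun d hd hdk => ?_⟩
      · have hkg : k ≠ g := fun e => hk (e ▸ ReflTransGen.refl)
        exact x.notMem_Y_of_mem_X (hne k hd hkg) h.1
      · rcases eq_or_ne d g with rfl | hdg
        · exact hr.isIndependent_upLabels x d ⟨hgx, y, hxy, hgy⟩ k h hdk
        · exact x.not_adj (hne d hd hdg) h.1 hdk
    · intro h
      exact hr.mem_upLabels_iff.2 ⟨le_iff_Y.1 hxy.le h.1, fun u hu hku =>
        hr.isIndependent_upLabels y k h u ((ih' u hku).1 hu) hku⟩

theorem mem_downLabels_congr [Finite V] (hr : G.IsOverlapRanking r) {x y : Mop G} (hxy : x ⋖ y)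
    {g : V} (hgy : g ∈ y.X) (hgx : g ∈ x.Y) (k : V) (hk : ¬ G.Geq g k) :
    k ∈ x.downLabels ↔ k ∈ y.downLabels := by
  rw [← upLabels_op, ← upLabels_op]
  exact (hr.op.mem_upLabels_congr (op_covBy_op.2 hxy) hgx hgy k (mt op_geq.1 hk)).symm

end IsOverlapRanking

/-- A greedy fold that starts inside a target set `T`, accepts only elements of `T`, and accepts
each of them when its turn comes, computes `T`. -/
theorem foldl_insert_eq {ℓ : List V} {P : Set V → V → Prop} {dec : ∀ A k, Decidable (P A k)}
    {A₀ T : Set V} (h₀ : A₀ ⊆ T) (hcover : ∀ t ∈ T, t ∈ A₀ ∨ t ∈ ℓ)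
    (hP : ∀ l₁ k l₂, ℓ = l₁ ++ k :: l₂ → ∀ A, A₀ ⊆ A → A ⊆ T → (∀ t ∈ T, t ∈ l₁ → t ∈ A) →
      (P A k → k ∈ T) ∧ (k ∈ T → k ∉ A → P A k)) :
    ℓ.foldl (fun A k => if P A k then insert k A else A) A₀ = T := by
  suffices H : ∀ l₂ l₁ A, ℓ = l₁ ++ l₂ → A₀ ⊆ A → A ⊆ T → (∀ t ∈ T, t ∈ l₁ → t ∈ A) →
      l₂.foldl (fun A k => if P A k then insert k A else A) A = T from
    H ℓ [] A₀ rfl subset_rfl h₀ fun _ _ h => absurd h List.not_mem_nil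
  intro l₂
  induction l₂ with
  | nil =>
    intro l₁ A hl hA hAT hseen
    refine Set.Subset.antisymm hAT fun t ht => (hcover t ht).elim (fun h => hA h) fun h => ?_
    rw [hl, List.append_nil] at h
    exact hseen t ht h
  | cons k l₂ ih =>
    intro l₁ A hl hA hAT hseen
    obtain ⟨h1, h2⟩ := hP l₁ k l₂ hl A hA hAT hseen
    rw [List.foldl_cons]
    refine ih (l₁ ++ [k]) _ (by simp [hl]) ?_ ?_ ?_
    · split_ifs
      · exact hA.trans (Set.subset_insert _ _)
      · exact hA
    · split_ifs with h
      · exact Set.insert_subset (h1 h) hAT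
      · exact hAT
    · intro t ht htl
      rw [List.mem_append, List.mem_singleton] at htl
      rcases htl with htl | rfl
      · have := hseen t ht htl
        split_ifs
        · exact Or.inr this
        · exact this
      · split_ifs with h
        · exact Or.inl rfl
        · by_contra hn
          exact h (h2 ht hn)

theorem IsLinearExtension.mem_of_adj {ℓ : List V} (hℓ : G.IsLinearExtension ℓ)
    (hG : ∀ v, ¬ G.Adj v v) {l₁ l₂ : List V} {k u : V} (h : ℓ = l₁ ++ k :: l₂)
    (hku : G.Adj k u) : u ∈ l₁ := by
  have hu := hℓ.2.1 u
  have hp := hℓ.2.2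
  rw [h, List.mem_append, List.mem_cons] at hu
  rw [h, List.pairwise_append, List.pairwise_cons] at hp
  rcases hu with hu | rfl | hu
  · exact hu
  · exact absurd hku (hG u)
  · exact absurd (ReflTransGen.single hku) (hp.2.1.1 u hu)

theorem IsReverseLinearExtension.mem_of_adj {ℓ : List V} (hℓ : G.IsReverseLinearExtension ℓ)
    (hG : ∀ v, ¬ G.Adj v v) {l₁ l₂ : List V} {k d : V} (h : ℓ = l₁ ++ k :: l₂)
    (hdk : G.Adj d k) : d ∈ l₁ := by
  obtain ⟨-, hmem, hp⟩ := hℓ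
  have hd := List.mem_reverse.1 (hmem d)
  rw [List.pairwise_reverse] at hp
  rw [h, List.mem_append, List.mem_cons] at hd
  rw [h, List.pairwise_append, List.pairwise_cons] at hp
  rcases hd with hd | rfl | hd
  · exact hd
  · exact absurd hdk (hG d)
  · exact absurd (ReflTransGen.single hdk) (hp.2.1.1 d hd)

/-- Flipping at the label of a cover relation passes to the upper cover. -/
theorem IsOverlapRanking.flip_labels [Finite V] {r : V → ℤ} (hr : G.IsOverlapRanking r)
    {ℓ ℓ' : List V} (hℓ : G.IsLinearExtension ℓ) (hℓ' : G.IsReverseLinearExtension ℓ')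
    {x y : Mop G} (hxy : x ⋖ y) {g : V} (hgy : g ∈ y.X) (hgx : g ∈ x.Y) :
    G.flip ℓ ℓ' g (x.downLabels, x.upLabels) = (y.downLabels, y.upLabels) := by
  have hgU : g ∈ x.upLabels := ⟨hgx, y, hxy, hgy⟩
  have hgD : g ∈ y.downLabels := ⟨hgy, x, hxy, hgx⟩
  have hgD' : g ∉ x.downLabels := fun h => x.notMem_Y_of_mem_X h.1 hgx
  have hDy := hr.isIndependent_downLabels y
  have hUy := hr.isIndependent_upLabels y
  -- The sets from which the flip starts already lie inside the labels of `y`; the two greedy passes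
  -- have to find only the remaining ones.
  have hU₀ : ({k | k ∈ x.upLabels ∧ ¬ G.Geq k g} ∪ {k | k = g ∧ g ∈ x.downLabels} : Set V) =
      {k | k ∈ y.upLabels ∧ ¬ G.Geq k g} := by
    ext k
    simp only [Set.mem_union, Set.mem_ofPred_eq, hgD', and_false, or_false]
    exact and_congr_left fun hk => hr.mem_upLabels_congr hxy hgy hgx k hk
  have hD₀ : ({k | k ∈ x.downLabels ∧ ¬ G.Geq g k} ∪ {k | k = g ∧ g ∈ x.upLabels} : Set V) =
      {k | k ∈ y.downLabels ∧ ¬ G.Geq g k} ∪ {g} := by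
    ext k
    simp only [Set.mem_union, Set.mem_ofPred_eq, hgU, and_true, Set.mem_singleton_iff]
    exact or_congr_left
      (and_congr_left fun hk => hr.mem_downLabels_congr hxy hgy hgx k hk)
  have hanti : ∀ {a b}, G.Geq a b → G.Geq b a → a = b := fun h h' =>
    hr.injective (le_antisymm (hr.le_of_geq h') (hr.le_of_geq h))
  -- The second pass tests against the output of the first, so the first equality is needed in
  -- proving the second.
  have and_of_imp : ∀ {p q : Prop}, p → (p → q) → p ∧ q := fun hp hpq => ⟨hp, hpq hp⟩
  unfold flip
  rw [if_neg (fun h => h.2 hgU)]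
  dsimp only
  rw [Prod.mk.injEq]
  refine and_of_imp ?_ fun hD₁ => ?_
  · refine foldl_insert_eq ?_ ?_ ?_
    · rw [hD₀]
      exact Set.union_subset (fun k hk => hk.1) (Set.singleton_subset_iff.2 hgD)
    · exact fun t _ => Or.inr (List.mem_reverse.1 (hℓ'.2.1 t))
    · intro l₁ k l₂ hl A hA hAT hseen
      rw [hD₀] at hA
      rw [hU₀]
      refine ⟨fun ⟨hk, hkU, hUk, hkA⟩ => ?_, fun hk hkA => ⟨fun hkg => hkA ?_,
        fun hkU => y.notMem_Y_of_mem_X hk.1 hkU.1.1, fun i hi => y.not_adj hk.1 hi.1.1,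
        fun i hi => hDy i (hAT hi) k hk⟩⟩
      · by_contra hkD
        have hkY : k ∈ y.Y := by
          rw [← hr.rightPerp_downLabels y]
          exact ⟨hkD, fun d hd hdk => hkA d (hseen d hd (hℓ'.mem_of_adj hr.irrefl hl hdk)) hdk⟩
        refine y.notMem_Y_of_mem_X ?_ hkY
        rw [← hr.leftPerp_upLabels y]
        -- Upper labels of `y` that were deleted for being `≥ g` cannot block `k`: an edge from `k`
        -- to one of them would make `k ≥ g`.
        refine ⟨fun hkU' => hkU ⟨hkU', hk⟩, fun u hu hku => hUk u ⟨hu, fun hug => ?_⟩ hku⟩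
        exact hk (ReflTransGen.head hku hug)
      · by_cases hgk : G.Geq g k
        · exact hA (Or.inr (hanti hkg hgk))
        · exact hA (Or.inl ⟨hk, hgk⟩)
  · refine foldl_insert_eq ?_ ?_ ?_
    · rw [hU₀]
      exact fun k hk => hk.1
    · exact fun t _ => Or.inr (hℓ.2.1 t)
    · intro l₁ k l₂ hl A hA hAT hseen
      rw [hU₀] at hA
      rw [hD₁]
      refine ⟨fun ⟨hk, hkD, hDk, hkA⟩ => ?_, fun hk hkA =>
        ⟨fun hgk => hkA (hA ⟨hk, fun hkg => ?_⟩), fun hkD => y.notMem_Y_of_mem_X hkD.1 hk.1,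
          fun i hi => y.not_adj hi.1 hk.1, fun i hi => hUy k hk i (hAT hi)⟩⟩
      · refine hr.mem_upLabels_iff.2 ⟨?_, fun u hu hku =>
          hkA u (hseen u hu (hℓ.mem_of_adj hr.irrefl hl hku)) hku⟩
        rw [← hr.rightPerp_downLabels y]
        exact ⟨hkD, hDk⟩
      · exact y.notMem_Y_of_mem_X hgy (hanti hgk hkg ▸ hk.1)

theorem IsLinearExtension.exists_equiv {ℓ : List V} (hℓ : G.IsLinearExtension ℓ) :
    ∃ e : Fin ℓ.length ≃ V, ∀ i j, i < j → ¬ G.Adj (e i) (e j) := by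
  classical
  exact ⟨List.Nodup.getEquivOfForallMemList ℓ hℓ.1 hℓ.2.1, fun i j hij hadj =>
    List.pairwise_iff_get.1 hℓ.2.2 i j hij (ReflTransGen.single hadj)⟩

end Digraph

/-! ### The isomorphism. -/

open Digraph

theorem mainTheorem4 {V : Type*} [Finite V] (G : Digraph V) (hG : G.IsAcyclic)
    (ℓ ℓ' : List V) (hℓ : G.IsLinearExtension ℓ) (hℓ' : G.IsReverseLinearExtension ℓ')
    (hL : IsTrimLattice G.Mop) :
    Nonempty (G.Mop ≃o G.IndependencePoset ℓ ℓ') := by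
  obtain ⟨e, he⟩ := hℓ.exists_equiv
  obtain ⟨r, hr⟩ := exists_isOverlapRanking e he (fun v hv => hG v (TransGen.single hv)) hL.2
  let f : G.Mop → G.IndependencePoset ℓ ℓ' := fun x =>
    ⟨x.downLabels, x.upLabels, hr.isTight_labels x⟩
  have hf : Function.Bijective f := by
    refine ⟨fun x y h => hr.downLabels_injective (congrArg IndependencePoset.D h), fun z => ?_⟩
    obtain ⟨x, hx⟩ := hr.exists_downLabels_eq z.tight.orthIndep.1
    refine ⟨x, IndependencePoset.ext hx (Set.ext fun k => ?_)⟩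
    exact hr.mem_iff_of_isTight (hx ▸ hr.isTight_labels x) z.tight k
  have hcov : ∀ {x y}, x ⋖ y ↔ IndependencePoset.FlipUp (f x) (f y) := by
    refine fun {x y} => ⟨fun hxy => ?_, ?_⟩
    · obtain ⟨g, hgy, hgx⟩ := hr.exists_mem hxy.lt
      exact ⟨g, ⟨hgx, y, hxy, hgy⟩, hr.flip_labels hℓ hℓ' hxy hgy hgx⟩
    -- As an upper label of `x`, `g` comes from a cover `x ⋖ y'`; the flip yields the labels of
    -- `y'`, and these identify `y'` with `y`.
    · rintro ⟨g, ⟨hgx, y', hxy', hgy'⟩, hflip⟩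
      have h : (y'.downLabels, y'.upLabels) = (y.downLabels, y.upLabels) :=
        (hr.flip_labels hℓ hℓ' hxy' hgy' hgx).symm.trans hflip
      rwa [← hr.downLabels_injective (congrArg Prod.fst h)]
  refine ⟨⟨Equiv.ofBijective f hf, fun {x y} => ?_⟩⟩
  change ReflTransGen IndependencePoset.FlipUp (f x) (f y) ↔ x ≤ y
  constructor
  · intro h
    obtain ⟨z, hz⟩ : ∃ z, z = f y := ⟨_, rfl⟩
    rw [← hz] at h
    induction h generalizing y with
    | refl => exact (hf.1 hz).le
    | @tail b c _ hbc ih =>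
      obtain ⟨w, rfl⟩ := hf.2 b
      exact (ih rfl).trans (hcov.2 (hz ▸ hbc)).le
  · intro h
    have := Fintype.ofFinite G.Mop
    classical
    have := Fintype.toLocallyFiniteOrder (α := G.Mop)
    exact (le_iff_reflTransGen_covBy.1 h).lift f fun _ _ => hcov.1
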